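/- Let $\mathcal H_d=\mathbb C^d$ and let $\mathcal E_0,\mathcal E_1:\mathcal B(\mathcal H_d)\to\mathcal B(\mathcal H_d)$ be quantum operations, that is, maps $\rho\mapsto\sum_{i=1}^m E_i\rho E_i^\dagger$ with $\sum_i E_i^\dagger E_i=I$; let $\mathcal I$ be the identity operation. For states $\rho_0,\rho_1$ put $$\tilde F(\rho_0,\rho_1)=\max\{|\langle\psi_0|\psi_1\rangle| : |\psi_k\rangle\in\mathrm{supp}(\rho_k)\text{ unit vectors},\ k=0,1\},$$ where $\mathrm{supp}(\rho)$ is the span of the eigenvectors of $\rho$ with positive eigenvalue. For quantum operations $\mathcal F_0,\mathcal F_1$ and $0\le q\le 1$ put $$\tilde F_q(\mathcal F_0,\mathcal F_1)=\min\{\tilde F(\mathcal F_0(|\psi_0\rangle\langle\psi_0|),\mathcal F_1(|\psi_1\rangle\langle\psi_1|)) : |\psi_0\rangle,|\psi_1\rangle\text{ unit vectors},\ \langle\psi_0|\psi_1\rangle=q\},$$ and let $\tilde F_q^{ea}(\mathcal F_0,\mathcal F_1)=\tilde F_q(\mathcal I^R\otimes\mathcal F_0,\mathcal I^R\otimes\mathcal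 F_1)$, where $R$ is an auxiliary system of the same dimension as the input system. A general scheme with $N$ queries to an unknown operation $X\in\{\mathcal E_0,\mathcal E_1\}$ consists of an initial state of $\mathcal H_d$ together with a finite-dimensional auxiliary system; then $N$ rounds, each consisting of one application of $X$ to $\mathcal H_d$ (and the identity to the auxiliary system) followed by a known quantum operation on the joint system, which may change the auxiliary system; and a final two-outcome measurement of the joint system. The operations $\mathcal E_0,\mathcal E_1$ are perfectly distinguishable if for some $N$ there is such a scheme whose measurement identifies $X$ with probability one, whether $X=\mathcal E_0$ or $X=\mathcal E_1$; the least such $N$ is the optimal query number $N_{\min}$. If $\mathcal E_0$ and $\mathcal E_1$ are perfectly distinguishable, then $\arccos\tilde F_1^{ea}(\mathcal E_0,\mathcal I)+\arccos\tilde F_1^{ea}(\mathcal E_1,\mathcal I)>0$ and $$N_{\min}\ \ge\ \left\lceil\frac{\pi}{2\left(\arccos\tilde F_1^{ea}(\mathcal E_0,\mathcal I)+\arccos\tilde F_1^{ea}(\mathcal E_1,\mathcal I)\right)}\right\rceil .$$ -/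

import Mathlib

open scoped Matrix ComplexOrder

noncomputable section

namespace QDisc

/-- Quantum operations from operators on `ℂⁿ` to operators on `ℂᵐ`: maps of the form
`ρ ↦ ∑ i, K i * ρ * (K i)ᴴ` with finitely many Kraus operators, `∑ i, (K i)ᴴ * K i = 1`. -/
def IsQuantumOperation {n m : Type} [Fintype n] [DecidableEq n] [Fintype m]
    (E : Matrix n n ℂ →ₗ[ℂ] Matrix m m ℂ) : Prop :=
  ∃ (k : ℕ) (K : Fin k → Matrix m n ℂ),
    ∑ i, (K i)ᴴ * K i = 1 ∧ ∀ ρ, E ρ = ∑ i, K i * ρ * (K i)ᴴ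

/-- Density operators: positive operators of trace one. -/
def IsState {n : Type} [Fintype n] (ρ : Matrix n n ℂ) : Prop :=
  ρ.PosSemidef ∧ ρ.trace = 1

/-- `|ψ⟩⟨ψ|`, the density operator of a pure state when `ψ` is a unit vector. -/
def pure {n : Type} (ψ : EuclideanSpace ℂ n) : Matrix n n ℂ :=
  Matrix.of fun i j => ψ i * star (ψ j)

/-- The support of a positive operator: the span of the eigenvectors whose eigenvalues are
positive. -/
def supp {n : Type} [Fintype n] [DecidableEq n] (ρ : Matrix n n ℂ) :
    Submodule ℂ (EuclideanSpace ℂ n) :=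
  Submodule.span ℂ {ψ | ∃ p : ℝ, 0 < p ∧ Matrix.toEuclideanLin ρ ψ = (p : ℂ) • ψ}

/-- The maximal fidelity of two states: the maximum of `|⟨ψ₀|ψ₁⟩|` over the pure states in
their supports. -/
def maxFidelity {n : Type} [Fintype n] [DecidableEq n] (ρ₀ ρ₁ : Matrix n n ℂ) : ℝ :=
  sSup {t | ∃ ψ₀ ∈ supp ρ₀, ∃ ψ₁ ∈ supp ρ₁, ‖ψ₀‖ = 1 ∧ ‖ψ₁‖ = 1 ∧ t = ‖inner ℂ ψ₀ ψ₁‖}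

/-- The `q`-maximal fidelity of two operations: the minimum of the maximal fidelity of the two
outputs over the pairs of pure inputs with `⟨ψ₀|ψ₁⟩ = q`. -/
def qMaxFidelity {n m : Type} [Fintype n] [Fintype m] [DecidableEq m] (q : ℝ)
    (E₀ E₁ : Matrix n n ℂ →ₗ[ℂ] Matrix m m ℂ) : ℝ :=
  sInf {t | ∃ ψ₀ ψ₁ : EuclideanSpace ℂ n, ‖ψ₀‖ = 1 ∧ ‖ψ₁‖ = 1 ∧ inner ℂ ψ₀ ψ₁ = (q : ℂ) ∧
    t = maxFidelity (E₀ (pure ψ₀)) (E₁ (pure ψ₁))}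

/-- `I ⊗ E`: the operation `E` applied to the second factor of a bipartite system, that is, to
every block of a matrix indexed by `R × n`. -/
def ampliate (R : Type) {n m : Type} (E : Matrix n n ℂ →ₗ[ℂ] Matrix m m ℂ) :
    Matrix (R × n) (R × n) ℂ →ₗ[ℂ] Matrix (R × m) (R × m) ℂ where
  toFun X := Matrix.of fun x y => E (Matrix.of fun a b => X (x.1, a) (y.1, b)) x.2 y.2
  map_add' X Y := by
    ext x y
    exact congrFun (congrFun (E.map_add (Matrix.of fun a b => X (x.1, a) (y.1, b))
      (Matrix.of fun a b => Y (x.1, a) (y.1, b))) x.2) y.2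
  map_smul' c X := by
    ext x y
    exact congrFun (congrFun (E.map_smul c (Matrix.of fun a b => X (x.1, a) (y.1, b))) x.2) y.2

/-- The entanglement-assisted `q`-maximal fidelity; the auxiliary system has the dimension of
the input system. -/
def qMaxFidelityEA {n m : Type} [Fintype n] [Fintype m] [DecidableEq n] [DecidableEq m] (q : ℝ)
    (E₀ E₁ : Matrix n n ℂ →ₗ[ℂ] Matrix m m ℂ) : ℝ :=
  qMaxFidelity q (ampliate n E₀) (ampliate n E₁)

/-- A general (adaptive, entanglement-assisted) scheme for querying an unknown operation on
`ℂᵈ`: an initial state of the system together with an auxiliary system, and, for each `k`, a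
known operation `T k` that is performed on both systems after the `(k+1)`-st query. The
auxiliary systems are arbitrary and may change from step to step. -/
structure Scheme (d : ℕ) where
  r : ℕ → ℕ
  init : Matrix (Fin (r 0) × Fin d) (Fin (r 0) × Fin d) ℂ
  init_state : IsState init
  T : ∀ k, Matrix (Fin (r k) × Fin d) (Fin (r k) × Fin d) ℂ →ₗ[ℂ]
    Matrix (Fin (r (k + 1)) × Fin d) (Fin (r (k + 1)) × Fin d) ℂ
  T_op : ∀ k, IsQuantumOperation (T k)

/-- The joint state after `N` queries to the operation `E`, each followed by the known
operation that the scheme prescribes. -/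
def Scheme.run {d : ℕ} (S : Scheme d) (E : Matrix (Fin d) (Fin d) ℂ →ₗ[ℂ] Matrix (Fin d) (Fin d) ℂ) :
    (N : ℕ) → Matrix (Fin (S.r N) × Fin d) (Fin (S.r N) × Fin d) ℂ
  | 0 => S.init
  | N + 1 => S.T N (ampliate (Fin (S.r N)) E (S.run E N))

/-- `E₀` and `E₁` can be told apart with certainty by `N` queries: for some scheme, a two-outcome
measurement `{M, 1 - M}` of the final state yields the first outcome with probability one if the
unknown operation is `E₀`, and the second with probability one if it is `E₁`. -/
def DistinguishableWith {d : ℕ} (N : ℕ)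
    (E₀ E₁ : Matrix (Fin d) (Fin d) ℂ →ₗ[ℂ] Matrix (Fin d) (Fin d) ℂ) : Prop :=
  ∃ (S : Scheme d) (M : Matrix (Fin (S.r N) × Fin d) (Fin (S.r N) × Fin d) ℂ),
    M.PosSemidef ∧ (1 - M).PosSemidef ∧
      (M * S.run E₀ N).trace = 1 ∧ ((1 - M) * S.run E₁ N).trace = 1

/-- Perfect distinguishability: finitely many queries suffice. -/
def PerfectlyDistinguishable {d : ℕ}
    (E₀ E₁ : Matrix (Fin d) (Fin d) ℂ →ₗ[ℂ] Matrix (Fin d) (Fin d) ℂ) : Prop :=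
  ∃ N, DistinguishableWith N E₀ E₁

/-- The optimal query number (meaningful for perfectly distinguishable operations). -/
def Nmin {d : ℕ} (E₀ E₁ : Matrix (Fin d) (Fin d) ℂ →ₗ[ℂ] Matrix (Fin d) (Fin d) ℂ) : ℕ :=
  sInf {N | DistinguishableWith N E₀ E₁}

end QDisc

end

/-! Compare both runs with a fictitious run in which every query is the identity. Purify all known
operations by isometries that record the Kraus index in an environment. These are the same for every
unknown operation, so they preserve angles between runs, and only queries move a run away from the
reference vector.

A query to `E` replaces a vector `v` by some unit vector `(1 ⊗ B) v`, with `B` in the span of the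
Kraus operators. `exists_localVec` chooses `B` so that the angle is at most `arccos` of the fidelity
of `E` to the identity. By induction (`Scheme.exists_purified_run`), `N` queries cost at most `N`
such angles, while all blocks of the vector stay in the support of the actual state. Perfect
discrimination makes these supports orthogonal, so the two final vectors are at angle `π / 2`, and
the triangle inequality through the reference vector gives the bound. -/

noncomputable section

namespace QDisc

/-! ### Supports of positive operators -/

section Support

variable {n m : Type} [Fintype n] [DecidableEq n] [Fintype m] [DecidableEq m]

/-- The support of a positive operator is the orthogonal complement of its kernel. -/
theorem mem_supp_iff {ρ : Matrix n n ℂ} (hρ : ρ.PosSemidef) (v : EuclideanSpace ℂ n) :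
    v ∈ supp ρ ↔ ∀ w : n → ℂ, ρ *ᵥ w = 0 → star w ⬝ᵥ v.ofLp = 0 := by
  constructor
  · intro hv w hw
    induction hv using Submodule.span_induction with
    | mem x hx =>
      obtain ⟨p, hp, hx⟩ := hx
      have hx' : ρ *ᵥ x.ofLp = (p : ℂ) • x.ofLp := by
        simpa [Matrix.toLpLin_apply] using congrArg WithLp.ofLp hx
      have h1 : star w ⬝ᵥ ρ *ᵥ x.ofLp = 0 := by
        rw [Matrix.dotProduct_mulVec, ← hρ.isHermitian.eq, ← Matrix.star_mulVec, hw]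
        simp
      rw [hx', dotProduct_smul, smul_eq_mul] at h1
      rcases mul_eq_zero.1 h1 with h2 | h2
      · exact absurd (by exact_mod_cast h2) hp.ne'
      · exact h2
    | zero => simp
    | add x y _ _ hx hy => simp [dotProduct_add, hx, hy]
    | smul a x _ hx => simp [dotProduct_smul, hx]
  · intro h
    rw [← hρ.isHermitian.eigenvectorBasis.sum_repr' v]
    refine Submodule.sum_mem _ fun i _ => ?_
    have hi := hρ.isHermitian.mulVec_eigenvectorBasis i
    rcases (hρ.eigenvalues_nonneg i).eq_or_lt with h0 | h0
    · have : inner ℂ (hρ.isHermitian.eigenvectorBasis i) v = 0 := by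
        rw [EuclideanSpace.inner_eq_star_dotProduct, dotProduct_comm]
        exact h _ (by rw [hi, ← h0, zero_smul])
      rw [this, zero_smul]
      exact Submodule.zero_mem _
    · refine Submodule.smul_mem _ _ (Submodule.subset_span ⟨_, h0, ?_⟩)
      ext j
      simpa [Matrix.toLpLin_apply] using congrFun hi j

/-- The kernel of a sum of positive operators lies in the kernel of each. If `w` is in it, then `(K
i)ᴴ w` lies in the kernel of `ρ`, hence is orthogonal to `v`. -/
theorem mulVec_mem_supp {ι : Type} [Fintype ι] {ρ : Matrix n n ℂ} (hρ : ρ.PosSemidef)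
    (K : ι → Matrix m n ℂ) {v : EuclideanSpace ℂ n} (hv : v ∈ supp ρ) (i : ι) :
    WithLp.toLp 2 (K i *ᵥ v.ofLp) ∈ supp (∑ i, K i * ρ * (K i)ᴴ) := by
  have hpos : ∀ i, (K i * ρ * (K i)ᴴ).PosSemidef := fun i => hρ.mul_mul_conjTranspose_same _
  rw [mem_supp_iff (Matrix.posSemidef_sum _ fun i _ => hpos i)]
  intro w hw
  have h1 : ∑ i, star w ⬝ᵥ (K i * ρ * (K i)ᴴ) *ᵥ w = 0 := by
    rw [← dotProduct_sum, ← Matrix.sum_mulVec, hw, dotProduct_zero]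
  rw [Finset.sum_eq_zero_iff_of_nonneg fun i _ => (hpos i).dotProduct_mulVec_nonneg w] at h1
  have h2 := h1 i (Finset.mem_univ i)
  have h3 : star ((K i)ᴴ *ᵥ w) ⬝ᵥ ρ *ᵥ ((K i)ᴴ *ᵥ w) = 0 := by
    rw [← h2, Matrix.star_mulVec, Matrix.conjTranspose_conjTranspose, ← Matrix.mulVec_mulVec,
      ← Matrix.mulVec_mulVec, Matrix.dotProduct_mulVec (star w) (K i)]
  have h4 := (mem_supp_iff hρ v).1 hv _ ((hρ.dotProduct_mulVec_zero_iff _).1 h3)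
  rwa [Matrix.star_mulVec, Matrix.conjTranspose_conjTranspose, ← Matrix.dotProduct_mulVec] at h4

theorem exists_unit_mem_supp {ρ : Matrix n n ℂ} (hρ : IsState ρ) : ∃ v ∈ supp ρ, ‖v‖ = 1 := by
  have h : ∃ i, hρ.1.isHermitian.eigenvalues i ≠ 0 := by
    by_contra! h
    have := hρ.2
    rw [hρ.1.isHermitian.trace_eq_sum_eigenvalues] at this
    simp [h] at this
  obtain ⟨i, hi⟩ := h
  refine ⟨hρ.1.isHermitian.eigenvectorBasis i, Submodule.subset_span
    ⟨_, (hρ.1.eigenvalues_nonneg i).lt_of_ne' hi, ?_⟩, by simp⟩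
  ext j
  simpa [Matrix.toLpLin_apply] using congrFun (hρ.1.isHermitian.mulVec_eigenvectorBasis i) j

open scoped MatrixOrder in
theorem exists_eq_conjTranspose_mul_self {ρ : Matrix n n ℂ} (hρ : ρ.PosSemidef) :
    ∃ B : Matrix n n ℂ, ρ = Bᴴ * B :=
  CStarAlgebra.nonneg_iff_eq_star_mul_self.1 hρ.nonneg

theorem mul_eq_zero_of_trace_mul_eq_zero {A B : Matrix n n ℂ} (hA : A.PosSemidef)
    (hB : B.PosSemidef) (h : (A * B).trace = 0) : A * B = 0 := by
  obtain ⟨C, rfl⟩ := exists_eq_conjTranspose_mul_self hA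
  obtain ⟨D, rfl⟩ := exists_eq_conjTranspose_mul_self hB
  have h1 : ((C * Dᴴ)ᴴ * (C * Dᴴ)).trace = 0 := by
    rw [← h, ← Matrix.mul_assoc _ Dᴴ D, Matrix.trace_mul_comm _ D]
    simp [Matrix.mul_assoc]
  have h2 := Matrix.trace_conjTranspose_mul_self_eq_zero_iff.1 h1
  rw [Matrix.mul_assoc, ← Matrix.mul_assoc C, h2]
  simp

theorem mulVec_eq_zero_of_mem_supp {M ρ : Matrix n n ℂ} (hM : M.PosSemidef) (hρ : ρ.PosSemidef)
    (h : (M * ρ).trace = 0) {v : EuclideanSpace ℂ n} (hv : v ∈ supp ρ) : M *ᵥ v.ofLp = 0 := by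
  have h0 : ρ * M = 0 := by
    have := congrArg Matrix.conjTranspose (mul_eq_zero_of_trace_mul_eq_zero hM hρ h)
    rwa [Matrix.conjTranspose_mul, hM.isHermitian.eq, hρ.isHermitian.eq,
      Matrix.conjTranspose_zero] at this
  have h1 := (mem_supp_iff hρ v).1 hv (M *ᵥ v.ofLp) (by rw [Matrix.mulVec_mulVec, h0]; simp)
  rwa [Matrix.star_mulVec, hM.isHermitian.eq, ← Matrix.dotProduct_mulVec,
    hM.dotProduct_mulVec_zero_iff] at h1

/-- A measurement that tells two states apart with certainty forces orthogonal supports. -/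
theorem inner_eq_zero_of_measurement {M ρ₀ ρ₁ : Matrix n n ℂ} (hM : M.PosSemidef)
    (hM' : (1 - M).PosSemidef) (hρ₀ : IsState ρ₀) (hρ₁ : IsState ρ₁) (h₀ : (M * ρ₀).trace = 1)
    (h₁ : ((1 - M) * ρ₁).trace = 1) {v₀ v₁ : EuclideanSpace ℂ n} (hv₀ : v₀ ∈ supp ρ₀)
    (hv₁ : v₁ ∈ supp ρ₁) : inner ℂ v₀ v₁ = 0 := by
  have e₀ : (1 - M) *ᵥ v₀.ofLp = 0 := mulVec_eq_zero_of_mem_supp hM' hρ₀.1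
    (by rw [Matrix.sub_mul, Matrix.one_mul, Matrix.trace_sub, h₀, hρ₀.2, sub_self]) hv₀
  have e₁ : M *ᵥ v₁.ofLp = 0 := mulVec_eq_zero_of_mem_supp hM hρ₁.1 (by
    rw [Matrix.sub_mul, Matrix.one_mul, Matrix.trace_sub, hρ₁.2] at h₁
    simpa using h₁) hv₁
  rw [Matrix.sub_mulVec, Matrix.one_mulVec, sub_eq_zero] at e₀
  rw [EuclideanSpace.inner_eq_star_dotProduct, e₀, Matrix.star_mulVec, hM.isHermitian.eq,
    dotProduct_comm, ← Matrix.dotProduct_mulVec, e₁, dotProduct_zero]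

end Support

/-! ### Quantum operations and their ampliations -/

section Operations

variable {n m : Type} [Fintype n] [DecidableEq n] [Fintype m]

theorem IsQuantumOperation.isState {E : Matrix n n ℂ →ₗ[ℂ] Matrix m m ℂ}
    (hE : IsQuantumOperation E) {ρ : Matrix n n ℂ} (hρ : IsState ρ) : IsState (E ρ) := by
  obtain ⟨k, K, hK, hE⟩ := hE
  rw [hE]
  refine ⟨Matrix.posSemidef_sum _ fun i _ => hρ.1.mul_mul_conjTranspose_same _, ?_⟩
  have : ∀ i, (K i * ρ * (K i)ᴴ).trace = ((K i)ᴴ * K i * ρ).trace := fun i => by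
    rw [Matrix.trace_mul_comm, ← Matrix.mul_assoc]
  rw [Matrix.trace_sum, Finset.sum_congr rfl fun i _ => this i, ← Matrix.trace_sum,
    ← Matrix.sum_mul, hK, Matrix.one_mul, hρ.2]

omit [DecidableEq n] [Fintype m] in
open scoped Kronecker in
theorem ampliate_eq_sum {R : Type} [Fintype R] [DecidableEq R]
    {E : Matrix n n ℂ →ₗ[ℂ] Matrix m m ℂ} {k : ℕ} {K : Fin k → Matrix m n ℂ}
    (hE : ∀ ρ, E ρ = ∑ i, K i * ρ * (K i)ᴴ) (ρ : Matrix (R × n) (R × n) ℂ) :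
    ampliate R E ρ = ∑ i, ((1 : Matrix R R ℂ) ⊗ₖ K i) * ρ * ((1 : Matrix R R ℂ) ⊗ₖ K i)ᴴ := by
  ext x y
  simp only [ampliate, LinearMap.coe_mk, AddHom.coe_mk, Matrix.of_apply, hE, Matrix.sum_apply,
    Matrix.mul_apply, Matrix.conjTranspose_apply, Matrix.kroneckerMap_apply, Matrix.one_apply,
    Fintype.sum_prod_type, ite_mul, one_mul, zero_mul, apply_ite star,
    star_zero, mul_ite, mul_zero, Finset.sum_ite_irrel, Finset.sum_const_zero,
    Finset.sum_ite_eq, Finset.mem_univ, if_true]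

open scoped Kronecker in
theorem IsQuantumOperation.ampliate (R : Type) [Fintype R] [DecidableEq R]
    {E : Matrix n n ℂ →ₗ[ℂ] Matrix m m ℂ} (hE : IsQuantumOperation E) :
    IsQuantumOperation (ampliate R E) := by
  obtain ⟨k, K, hK, hE⟩ := hE
  refine ⟨k, fun i => (1 : Matrix R R ℂ) ⊗ₖ K i, ?_, ampliate_eq_sum hE⟩
  simp_rw [Matrix.conjTranspose_kronecker, Matrix.conjTranspose_one, ← Matrix.mul_kronecker_mul,
    Matrix.one_mul]
  rw [← Matrix.one_kronecker_one, ← hK]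
  ext x y
  simp [Matrix.sum_apply, Finset.mul_sum]

theorem Scheme.isState_run {d : ℕ} (S : Scheme d)
    {E : Matrix (Fin d) (Fin d) ℂ →ₗ[ℂ] Matrix (Fin d) (Fin d) ℂ} (hE : IsQuantumOperation E) :
    ∀ N, IsState (S.run E N)
  | 0 => S.init_state
  | N + 1 => (S.T_op N).isState ((hE.ampliate _).isState (S.isState_run hE N))

end Operations

/-! ### The triangle inequality for angles -/

section Angle

variable {V : Type} [NormedAddCommGroup V] [InnerProductSpace ℂ V]

/-- The real part of the inner product is the inner product of the underlying real space, where
angles obey the triangle inequality. -/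
theorem arccos_re_inner_le_add {x y z : V} (hx : ‖x‖ = 1) (hy : ‖y‖ = 1) (hz : ‖z‖ = 1) :
    Real.arccos (inner ℂ x z).re ≤
      Real.arccos (inner ℂ x y).re + Real.arccos (inner ℂ y z).re := by
  let _ : InnerProductSpace ℝ V := InnerProductSpace.complexToReal
  have h := InnerProductGeometry.angle_le_angle_add_angle x y z
  simpa [InnerProductGeometry.angle, hx, hy, hz, real_inner_eq_re_inner ℂ] using h

end Angle

/-! ### Operators acting on one half of a bipartite vector -/

section LocalVec

variable {A n m l : Type} [Fintype n]

/-- `(1 ⊗ B) ψ`, as a linear function of `B`. -/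
def localVec (ψ : EuclideanSpace ℂ (A × n)) : Matrix m n ℂ →ₗ[ℂ] EuclideanSpace ℂ (A × m) where
  toFun B := WithLp.toLp 2 fun x => ∑ b, B x.2 b * ψ (x.1, b)
  map_add' B C := by
    ext x
    simp [add_mul, Finset.sum_add_distrib]
  map_smul' c B := by
    ext x
    simp [Finset.mul_sum, mul_assoc]

theorem localVec_apply (ψ : EuclideanSpace ℂ (A × n)) (B : Matrix m n ℂ) (x : A × m) :
    localVec ψ B x = ∑ b, B x.2 b * ψ (x.1, b) := rfl

open scoped Kronecker in
theorem localVec_eq_kronecker_mulVec [Fintype A] [DecidableEq A] (ψ : EuclideanSpace ℂ (A × n))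
    (B : Matrix m n ℂ) : (localVec ψ B).ofLp = ((1 : Matrix A A ℂ) ⊗ₖ B) *ᵥ ψ.ofLp := by
  ext x
  simp [localVec_apply, Matrix.mulVec, dotProduct, Fintype.sum_prod_type, Matrix.one_apply,
    Finset.sum_ite_irrel]

theorem localVec_one [DecidableEq n] (ψ : EuclideanSpace ℂ (A × n)) :
    localVec ψ (1 : Matrix n n ℂ) = ψ := by
  ext x
  simp [localVec_apply, Matrix.one_apply]

theorem localVec_mul [Fintype m] (ψ : EuclideanSpace ℂ (A × n)) (C : Matrix l m ℂ)
    (B : Matrix m n ℂ) : localVec ψ (C * B) = localVec (localVec ψ B) C := by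
  ext x
  simp only [localVec_apply, Matrix.mul_apply, Finset.sum_mul, Finset.mul_sum, mul_assoc]
  exact Finset.sum_comm

/-- The matrix of inner products of the columns of a bipartite vector. -/
def gram [Fintype A] (ψ : EuclideanSpace ℂ (A × n)) : Matrix n n ℂ :=
  (Matrix.of fun x a => ψ (x, a))ᴴ * Matrix.of fun x a => ψ (x, a)

theorem inner_localVec [Fintype A] [Fintype m] (ψ : EuclideanSpace ℂ (A × n))
    (B C : Matrix m n ℂ) :
    inner ℂ (localVec ψ B) (localVec ψ C) =
      ∑ c, ∑ a, ∑ b, star (B c a) * C c b * gram ψ a b := by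
  simp only [PiLp.inner_apply, RCLike.inner_apply, localVec_apply, Fintype.sum_prod_type, gram,
    Matrix.mul_apply, Matrix.conjTranspose_apply, Matrix.of_apply, Finset.mul_sum, map_sum,
    Finset.sum_mul, map_mul, starRingEnd_apply]
  rw [Finset.sum_comm]
  refine Finset.sum_congr rfl fun c _ => ?_
  rw [Finset.sum_comm]
  refine Finset.sum_congr rfl fun b _ => ?_
  rw [Finset.sum_comm]
  refine Finset.sum_congr rfl fun a _ => Finset.sum_congr rfl fun x _ => ?_
  ring

/-- A positive square root factor of the Gram matrix is square. Inner products of the vectors `(1 ⊗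
B) ψ` depend only on `gram ψ`, so the auxiliary system can be taken of dimension `n`. -/
theorem exists_gram_eq [DecidableEq n] [Fintype A] (ψ : EuclideanSpace ℂ (A × n)) :
    ∃ ψ' : EuclideanSpace ℂ (n × n), gram ψ' = gram ψ := by
  obtain ⟨P, hP⟩ := exists_eq_conjTranspose_mul_self
    (Matrix.posSemidef_conjTranspose_mul_self (Matrix.of fun x a => ψ (x, a)))
  exact ⟨WithLp.toLp 2 fun x => P x.1 x.2, hP.symm⟩

end LocalVec

/-! ### Pure states and sums of them -/

section Pure

variable {n : Type}

theorem pure_eq_vecMulVec (ψ : EuclideanSpace ℂ n) :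
    pure ψ = Matrix.vecMulVec ψ.ofLp (star ψ.ofLp) := rfl

variable [Fintype n]

theorem mul_pure_mul_conjTranspose {m : Type} (ψ : EuclideanSpace ℂ n) (B : Matrix m n ℂ) :
    B * pure ψ * Bᴴ = pure (WithLp.toLp 2 (B *ᵥ ψ.ofLp)) := by
  simp [pure_eq_vecMulVec, Matrix.mul_vecMulVec, Matrix.vecMulVec_mul, Matrix.star_mulVec]

theorem toEuclideanLin_pure [DecidableEq n] (ψ φ : EuclideanSpace ℂ n) :
    Matrix.toEuclideanLin (pure ψ) φ = inner ℂ ψ φ • ψ := by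
  ext i
  simp [pure_eq_vecMulVec, Matrix.toLpLin_apply, Matrix.vecMulVec_mulVec,
    EuclideanSpace.inner_eq_star_dotProduct, dotProduct_comm, mul_comm]

/-- The operator has its range in the span of the `ψ i`, and an eigenvector with nonzero eigenvalue
lies in the range. -/
theorem supp_sum_pure_le [DecidableEq n] {ι : Type} [Fintype ι] (ψ : ι → EuclideanSpace ℂ n)
    (V : Submodule ℂ (EuclideanSpace ℂ n)) (hV : ∀ i, ψ i ∈ V) : supp (∑ i, pure (ψ i)) ≤ V := by
  refine Submodule.span_le.2 ?_
  rintro φ ⟨p, hp, h⟩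
  rw [map_sum, LinearMap.sum_apply] at h
  simp_rw [toEuclideanLin_pure] at h
  have h0 : (p : ℂ) ≠ 0 := by exact_mod_cast hp.ne'
  have := V.smul_mem (p : ℂ)⁻¹ (h ▸ V.sum_mem fun i _ => V.smul_mem _ (hV i))
  rwa [inv_smul_smul₀ h0] at this

end Pure

/-! ### From fidelity to angles -/

section Fidelity

variable {n m : Type} [Fintype n] [DecidableEq n]

theorem maxFidelity_nonneg (ρ₀ ρ₁ : Matrix n n ℂ) : 0 ≤ maxFidelity ρ₀ ρ₁ := by
  refine Real.sSup_nonneg ?_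
  rintro t ⟨ψ₀, -, ψ₁, -, -, -, rfl⟩
  exact norm_nonneg _

theorem qMaxFidelity_le [Fintype m] {q : ℝ} (E₀ E₁ : Matrix m m ℂ →ₗ[ℂ] Matrix n n ℂ)
    {ψ₀ ψ₁ : EuclideanSpace ℂ m} (h₀ : ‖ψ₀‖ = 1) (h₁ : ‖ψ₁‖ = 1)
    (h : inner ℂ ψ₀ ψ₁ = (q : ℂ)) :
    qMaxFidelity q E₀ E₁ ≤ maxFidelity (E₀ (pure ψ₀)) (E₁ (pure ψ₁)) := by
  refine csInf_le ⟨0, ?_⟩ ⟨ψ₀, ψ₁, h₀, h₁, h, rfl⟩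
  rintro t ⟨ψ₀, ψ₁, -, -, -, rfl⟩
  exact maxFidelity_nonneg _ _

theorem maxFidelity_pure_le (ρ : Matrix n n ℂ) {ψ : EuclideanSpace ℂ n} (hψ : ‖ψ‖ = 1)
    {V : Submodule ℂ (EuclideanSpace ℂ n)} (hV : supp ρ ≤ V) :
    maxFidelity ρ (pure ψ) ≤ ‖V.starProjection ψ‖ := by
  refine Real.sSup_le ?_ (norm_nonneg _)
  rintro t ⟨u, hu, φ, hφ, hu1, hφ1, rfl⟩
  have h1 : φ ∈ Submodule.span ℂ {ψ} := by
    have := supp_sum_pure_le (fun _ : Unit => ψ) (Submodule.span ℂ {ψ})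
      (fun _ => Submodule.mem_span_singleton_self ψ)
    simp only [Finset.univ_unique, Finset.sum_singleton] at this
    exact this hφ
  obtain ⟨c, rfl⟩ := Submodule.mem_span_singleton.1 h1
  have hc : ‖c‖ = 1 := by simpa [norm_smul, hψ] using hφ1
  have h2 : inner ℂ u ψ = inner ℂ u (V.starProjection ψ) := by
    rw [← V.inner_starProjection_left_eq_right, V.starProjection_eq_self_iff.2 (hV hu)]
  rw [inner_smul_right, norm_mul, hc, one_mul, h2]
  simpa [hu1] using norm_inner_le_norm (𝕜 := ℂ) u (V.starProjection ψ)

/-- A nonzero subspace contains a unit vector at the least possible angle to a given one. -/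
theorem exists_unit_mem_arccos_le {V : Type} [NormedAddCommGroup V] [InnerProductSpace ℂ V]
    (W : Submodule ℂ V) [W.HasOrthogonalProjection] (hW : W ≠ ⊥) (ψ : V) :
    ∃ u ∈ W, ‖u‖ = 1 ∧ Real.arccos (inner ℂ ψ u).re ≤ Real.arccos ‖W.starProjection ψ‖ := by
  by_cases h : W.starProjection ψ = 0
  -- Here `ψ` is orthogonal to `W`, so any unit vector of `W` attains the angle `arccos 0`.
  · obtain ⟨w, hw, hw0⟩ := W.exists_mem_ne_zero_of_ne_bot hW
    refine ⟨((‖w‖ : ℂ)⁻¹) • w, W.smul_mem _ hw, by simp [norm_smul, hw0], ?_⟩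
    have : inner ℂ ψ w = 0 := by
      rw [← W.starProjection_eq_self_iff.2 hw, ← W.inner_starProjection_left_eq_right, h,
        inner_zero_left]
    simp [this, h]
  · have h0 : ‖W.starProjection ψ‖ ≠ 0 := norm_ne_zero_iff.2 h
    -- The normalized projection has a real positive inner product with `ψ`, so taking the real part
    -- loses nothing.
    refine ⟨((‖W.starProjection ψ‖ : ℂ)⁻¹) • W.starProjection ψ,
      W.smul_mem _ (W.starProjection_apply_mem ψ), by simp [norm_smul, h], ?_⟩
    have : inner ℂ ψ (W.starProjection ψ) = (‖W.starProjection ψ‖ : ℂ) ^ 2 := by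
      have h1 := inner_self_eq_norm_sq_to_K (𝕜 := ℂ) (W.starProjection ψ)
      rwa [W.inner_starProjection_left_eq_right,
        W.starProjection_eq_self_iff.2 (W.starProjection_apply_mem ψ)] at h1
    refine Real.arccos_le_arccos (le_of_eq ?_)
    rw [inner_smul_right, this, sq, inv_mul_cancel_left₀ (by exact_mod_cast h0),
      Complex.ofReal_re]

theorem exists_localVec_square {E : Matrix n n ℂ →ₗ[ℂ] Matrix n n ℂ} {k : ℕ}
    {K : Fin k → Matrix n n ℂ} (hK : ∑ i, (K i)ᴴ * K i = 1)
    (hE : ∀ ρ, E ρ = ∑ i, K i * ρ * (K i)ᴴ) {ψ : EuclideanSpace ℂ (n × n)} (hψ : ‖ψ‖ = 1) :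
    ∃ B ∈ Submodule.span ℂ (Set.range K), ‖localVec ψ B‖ = 1 ∧
      Real.arccos (inner ℂ ψ (localVec ψ B)).re ≤
        Real.arccos (qMaxFidelityEA 1 E LinearMap.id) := by
  set W := (Submodule.span ℂ (Set.range K)).map (localVec ψ) with hW
  have hmem : ∀ i, localVec ψ (K i) ∈ W := fun i =>
    Submodule.mem_map_of_mem (Submodule.subset_span ⟨i, rfl⟩)
  have hne : W ≠ ⊥ := by
    intro h
    have h0 : ∀ i, localVec ψ (K i) = 0 := fun i => by simpa [h] using hmem i
    have h1 : ψ = 0 := by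
      rw [← localVec_one ψ, ← hK, map_sum]
      refine Finset.sum_eq_zero fun i _ => ?_
      rw [localVec_mul, h0]
      ext x
      simp [localVec_apply]
    simp [h1] at hψ
  have hsupp : supp (ampliate n E (pure ψ)) ≤ W := by
    rw [ampliate_eq_sum hE]
    simp_rw [mul_pure_mul_conjTranspose, ← localVec_eq_kronecker_mulVec]
    exact supp_sum_pure_le _ _ hmem
  obtain ⟨u, hu, hu1, hle⟩ := exists_unit_mem_arccos_le W hne ψ
  obtain ⟨B, hB, rfl⟩ := hu
  refine ⟨B, hB, hu1, hle.trans (Real.arccos_le_arccos ?_)⟩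
  -- Inputs with inner product `1` include the pair `(ψ, ψ)`.
  have h1 : qMaxFidelityEA 1 E LinearMap.id ≤
      maxFidelity (ampliate n E (pure ψ)) (ampliate n LinearMap.id (pure ψ)) :=
    qMaxFidelity_le _ _ hψ hψ (by simp [inner_self_eq_norm_sq_to_K, hψ])
  exact h1.trans (maxFidelity_pure_le _ hψ hsupp)

/-- For a unit vector shared with an auxiliary system of any dimension, the entanglement-assisted
fidelity to the identity bounds the angle to some vector in the support of the output. -/
theorem exists_localVec {A : Type} [Fintype A] {E : Matrix n n ℂ →ₗ[ℂ] Matrix n n ℂ} {k : ℕ}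
    {K : Fin k → Matrix n n ℂ} (hK : ∑ i, (K i)ᴴ * K i = 1)
    (hE : ∀ ρ, E ρ = ∑ i, K i * ρ * (K i)ᴴ) {ψ : EuclideanSpace ℂ (A × n)} (hψ : ‖ψ‖ = 1) :
    ∃ B ∈ Submodule.span ℂ (Set.range K), ‖localVec ψ B‖ = 1 ∧
      Real.arccos (inner ℂ ψ (localVec ψ B)).re ≤
        Real.arccos (qMaxFidelityEA 1 E LinearMap.id) := by
  obtain ⟨ψ', hg⟩ := exists_gram_eq ψ
  have hinner : ∀ B C : Matrix n n ℂ,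
      inner ℂ (localVec ψ' B) (localVec ψ' C) = inner ℂ (localVec ψ B) (localVec ψ C) :=
    fun B C => by rw [inner_localVec, inner_localVec, hg]
  have hnorm : ∀ B : Matrix n n ℂ, ‖localVec ψ' B‖ = ‖localVec ψ B‖ := fun B => by
    rw [norm_eq_sqrt_re_inner (𝕜 := ℂ), hinner, ← norm_eq_sqrt_re_inner]
  have hψ' : ‖ψ'‖ = 1 := by rw [← localVec_one ψ', hnorm, localVec_one, hψ]
  obtain ⟨B, hB, h1, h2⟩ := exists_localVec_square hK hE hψ'
  refine ⟨B, hB, by rw [← hnorm, h1], ?_⟩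
  have := hinner 1 B
  rw [localVec_one, localVec_one] at this
  rwa [← this]

end Fidelity

/-! ### Purified runs and their deviation from the reference -/

section Paths

variable {ε R R' n : Type}

/-- The part of a vector that belongs to the environment state `e`. -/
def block (v : EuclideanSpace ℂ ((ε × R) × n)) (e : ε) : EuclideanSpace ℂ (R × n) :=
  WithLp.toLp 2 fun x => v ((e, x.1), x.2)

theorem block_localVec [Fintype n] (v : EuclideanSpace ℂ ((ε × R) × n)) (B : Matrix n n ℂ)
    (e : ε) : block (localVec v B) e = localVec (block v e) B := rfl

theorem inner_eq_sum_block [Fintype ε] [Fintype R] [Fintype n]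
    (v w : EuclideanSpace ℂ ((ε × R) × n)) :
    inner ℂ v w = ∑ e, inner ℂ (block v e) (block w e) := by
  simp [PiLp.inner_apply, Fintype.sum_prod_type, block]

/-- The isometry that records the Kraus index of an operation in the environment. -/
def dilate [Fintype R] [Fintype n] {k : ℕ} (K : Fin k → Matrix (R' × n) (R × n) ℂ)
    (v : EuclideanSpace ℂ ((ε × R) × n)) : EuclideanSpace ℂ (((ε × Fin k) × R') × n) :=
  WithLp.toLp 2 fun x => (K x.1.1.2 *ᵥ (block v x.1.1.1).ofLp) (x.1.2, x.2)

theorem block_dilate [Fintype R] [Fintype n] {k : ℕ} (K : Fin k → Matrix (R' × n) (R × n) ℂ)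
    (v : EuclideanSpace ℂ ((ε × R) × n)) (e : ε × Fin k) :
    block (dilate K v) e = WithLp.toLp 2 (K e.2 *ᵥ (block v e.1).ofLp) := rfl

theorem inner_dilate [Fintype ε] [Fintype R] [Fintype R'] [Fintype n] [DecidableEq R]
    [DecidableEq n] {k : ℕ} {K : Fin k → Matrix (R' × n) (R × n) ℂ}
    (hK : ∑ i, (K i)ᴴ * K i = 1) (v w : EuclideanSpace ℂ ((ε × R) × n)) :
    inner ℂ (dilate K v) (dilate K w) = inner ℂ v w := by
  rw [inner_eq_sum_block, inner_eq_sum_block, Fintype.sum_prod_type]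
  refine Finset.sum_congr rfl fun e _ => ?_
  have h : ∀ i, inner ℂ (block (dilate K v) (e, i)) (block (dilate K w) (e, i)) =
      star (block v e).ofLp ⬝ᵥ ((K i)ᴴ * K i) *ᵥ (block w e).ofLp := fun i => by
    rw [EuclideanSpace.inner_eq_star_dotProduct, dotProduct_comm]
    simp only [block_dilate]
    rw [Matrix.star_mulVec, ← Matrix.mulVec_mulVec, Matrix.dotProduct_mulVec,
      Matrix.dotProduct_mulVec, Matrix.dotProduct_mulVec]
  rw [Finset.sum_congr rfl fun i _ => h i, ← dotProduct_sum, ← Matrix.sum_mulVec, hK,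
    Matrix.one_mulVec, EuclideanSpace.inner_eq_star_dotProduct, dotProduct_comm]

theorem norm_dilate [Fintype ε] [Fintype R] [Fintype R'] [Fintype n] [DecidableEq R]
    [DecidableEq n] {k : ℕ} {K : Fin k → Matrix (R' × n) (R × n) ℂ}
    (hK : ∑ i, (K i)ᴴ * K i = 1) (v : EuclideanSpace ℂ ((ε × R) × n)) :
    ‖dilate K v‖ = ‖v‖ := by
  rw [norm_eq_sqrt_re_inner (𝕜 := ℂ), inner_dilate hK, ← norm_eq_sqrt_re_inner]

/-- Each Kraus operator sends `v` into the support of the output. The support is a subspace, so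
their linear combinations do too. -/
theorem localVec_mem_supp [Fintype R] [DecidableEq R] [Fintype n] [DecidableEq n]
    {E : Matrix n n ℂ →ₗ[ℂ] Matrix n n ℂ} {k : ℕ} {K : Fin k → Matrix n n ℂ}
    (hE : ∀ ρ, E ρ = ∑ i, K i * ρ * (K i)ᴴ) {ρ : Matrix (R × n) (R × n) ℂ} (hρ : ρ.PosSemidef)
    {v : EuclideanSpace ℂ (R × n)} (hv : v ∈ supp ρ) {B : Matrix n n ℂ}
    (hB : B ∈ Submodule.span ℂ (Set.range K)) : localVec v B ∈ supp (ampliate R E ρ) := by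
  have : Submodule.span ℂ (Set.range K) ≤ (supp (ampliate R E ρ)).comap (localVec v) := by
    refine Submodule.span_le.2 ?_
    rintro _ ⟨i, rfl⟩
    have h := mulVec_mem_supp hρ (fun i => Matrix.kroneckerMap (· * ·) (1 : Matrix R R ℂ) (K i))
      hv i
    rw [← localVec_eq_kronecker_mulVec, ← ampliate_eq_sum hE] at h
    exact h
  exact this hB

/-- Replacing each query of a scheme by the identity gives a purified final state from which
every purified run deviates by a controlled angle. -/
theorem Scheme.exists_purified_run {d : ℕ} (S : Scheme d) (N : ℕ) :
    ∃ (ε : Type) (_ : Fintype ε) (φ : EuclideanSpace ℂ ((ε × Fin (S.r N)) × Fin d)), ‖φ‖ = 1 ∧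
      ∀ E : Matrix (Fin d) (Fin d) ℂ →ₗ[ℂ] Matrix (Fin d) (Fin d) ℂ, IsQuantumOperation E →
        ∃ v : EuclideanSpace ℂ ((ε × Fin (S.r N)) × Fin d), ‖v‖ = 1 ∧
          Real.arccos (inner ℂ φ v).re ≤
            N * Real.arccos (qMaxFidelityEA 1 E LinearMap.id) ∧
          ∀ e, block v e ∈ supp (S.run E N) := by
  induction N with
  | zero =>
    obtain ⟨u, hu, hu1⟩ := exists_unit_mem_supp S.init_state
    let φ : EuclideanSpace ℂ ((Unit × Fin (S.r 0)) × Fin d) :=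
      WithLp.toLp 2 fun x => u (x.1.2, x.2)
    have hb : ∀ e, block φ e = u := fun e => rfl
    have hin : inner ℂ φ φ = 1 := by
      rw [inner_eq_sum_block]
      simp [hb, inner_self_eq_norm_sq_to_K, hu1]
    have hφ : ‖φ‖ = 1 := by
      rw [norm_eq_sqrt_re_inner (𝕜 := ℂ), hin]
      simp
    exact ⟨Unit, inferInstance, φ, hφ, fun E _ => ⟨φ, hφ, by rw [hin]; simp, fun e => hu⟩⟩
  | succ N ih =>
    obtain ⟨ε, hε, φ, hφ, h⟩ := ih
    obtain ⟨k, K, hK, hT⟩ := S.T_op N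
    -- The reference vector skips the query and undergoes only the known operation, so it does not
    -- depend on `E`.
    refine ⟨ε × Fin k, inferInstance, dilate K φ, by rw [norm_dilate hK, hφ], fun E hE => ?_⟩
    obtain ⟨v, hv, hle, hb⟩ := h E hE
    obtain ⟨l, L, hL, hEL⟩ := hE
    obtain ⟨B, hB, hB1, hB2⟩ := exists_localVec hL hEL hv
    have hE : IsQuantumOperation E := ⟨l, L, hL, hEL⟩
    refine ⟨dilate K (localVec v B), by rw [norm_dilate hK, hB1], ?_, fun e => ?_⟩
    · rw [inner_dilate hK]
      have := arccos_re_inner_le_add hφ hv hB1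
      push_cast
      linarith
    · rw [block_dilate, block_localVec]
      have h1 := localVec_mem_supp hEL (S.isState_run hE N).1 (hb e.1) hB
      have h2 := mulVec_mem_supp ((hE.ampliate _).isState (S.isState_run hE N)).1 K h1 e.2
      rw [← hT] at h2
      exact h2

end Paths

theorem pi_div_two_le_of_distinguishableWith {d N : ℕ}
    {E₀ E₁ : Matrix (Fin d) (Fin d) ℂ →ₗ[ℂ] Matrix (Fin d) (Fin d) ℂ}
    (hE₀ : IsQuantumOperation E₀) (hE₁ : IsQuantumOperation E₁)
    (h : DistinguishableWith N E₀ E₁) :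
    Real.pi / 2 ≤ N * (Real.arccos (qMaxFidelityEA 1 E₀ LinearMap.id) +
      Real.arccos (qMaxFidelityEA 1 E₁ LinearMap.id)) := by
  obtain ⟨S, M, hM, hM', h₀, h₁⟩ := h
  obtain ⟨ε, _, φ, hφ, hpath⟩ := S.exists_purified_run N
  obtain ⟨v₀, hv₀, hle₀, hb₀⟩ := hpath E₀ hE₀
  obtain ⟨v₁, hv₁, hle₁, hb₁⟩ := hpath E₁ hE₁
  -- Orthogonality holds separately for each environment state.
  have horth : inner ℂ v₀ v₁ = 0 := by
    rw [inner_eq_sum_block]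
    exact Finset.sum_eq_zero fun e _ => inner_eq_zero_of_measurement hM hM'
      (S.isState_run hE₀ N) (S.isState_run hE₁ N) h₀ h₁ (hb₀ e) (hb₁ e)
  have htri := arccos_re_inner_le_add hv₀ hφ hv₁
  rw [horth, Complex.zero_re, Real.arccos_zero, ← inner_conj_symm, Complex.conj_re] at htri
  linarith

end QDisc
end

theorem mainTheorem7 {d : ℕ}
    (E₀ E₁ : Matrix (Fin d) (Fin d) ℂ →ₗ[ℂ] Matrix (Fin d) (Fin d) ℂ)
    (hE₀ : QDisc.IsQuantumOperation E₀) (hE₁ : QDisc.IsQuantumOperation E₁)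
    (h : QDisc.PerfectlyDistinguishable E₀ E₁) :
    0 < Real.arccos (QDisc.qMaxFidelityEA 1 E₀ LinearMap.id) +
          Real.arccos (QDisc.qMaxFidelityEA 1 E₁ LinearMap.id) ∧
      ⌈Real.pi / (2 * (Real.arccos (QDisc.qMaxFidelityEA 1 E₀ LinearMap.id) +
          Real.arccos (QDisc.qMaxFidelityEA 1 E₁ LinearMap.id)))⌉₊ ≤ QDisc.Nmin E₀ E₁ := by
  -- The infimum of a nonempty set of naturals is attained, so the bound applies to `Nmin` itself.
  -- Its left side is positive, which forces the sum of angles to be positive.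
  have hN := QDisc.pi_div_two_le_of_distinguishableWith hE₀ hE₁ (Nat.sInf_mem h)
  have hpos := pos_of_mul_pos_right (Real.pi_div_two_pos.trans_le hN) (Nat.cast_nonneg _)
  refine ⟨hpos, Nat.ceil_le.2 ?_⟩
  rw [← div_div]
  exact (div_le_iff₀ hpos).2 hN
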